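/- Let $n\in\mathbb N$ and let $V:\mathbb R^n\times\mathbb R\to\mathbb R^n$, $(x,\rho)\mapsto V(x,\rho)$, be real-analytic with $V(0,0)=0$. Let $A=\nabla_xV(0,0)\in\mathbb R^{n\times n}$ be the Jacobian matrix of $V$ in the variable $x$ at the origin, and let $\lambda_1,\dots,\lambda_n\in\mathbb C$ be its eigenvalues. Consider the singular initial value problem $$\frac{dx}{dr}=\frac{V(x,r^2)}{r}\quad\text{for } 0<r<r_0,\qquad x(0)=0. \tag{1}$$ Say that $x$ is *analytic in $r^2$ near $0$* if there are $\varepsilon>0$ and a real-analytic $g:(-\varepsilon,\varepsilon)\to\mathbb R^n$ with $g(0)=0$ such that $x(r)=g(r^2)$ for all $r$ sufficiently close to $0$. If $\operatorname{Re}(\lambda_i)\notin 2\mathbb N_+=\{2,4,6,\dots\}$ for all $1\le i\le n$, then there is exactly one local solution of (1) that is analytic in $r^2$ near $0$. That is: (i) for some $r_0>0$ there is a solution $x$ of (1) that is analytic in $r^2$ near $0$; (ii) if $x_1$ and $x_2$ are solutions of (1) on $0<r<r_1$ and on $0<r<r_2$, respectively, where $r_1,r_2>0$, and both are analytic in $r^2$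 near $0$, then $x_1(r)=x_2(r)$ for all $0\le r<\min(r_1,r_2)$ and also for all $r$ in a neighbourhood of $0$. -/

import Mathlib

open Set Filter Topology

namespace SingularODE

noncomputable section

/-- The Jacobian matrix `A = ∇ₓ V (0)` of `V : ℝⁿ × ℝ → ℝⁿ` in the first variable at the origin:
the entry `A i j` is the partial derivative of the `i`-th component of `V` with respect to `x j`
at `(x, ρ) = (0, 0)`. -/
def jacobian {n : ℕ} (V : EuclideanSpace ℝ (Fin n) × ℝ → EuclideanSpace ℝ (Fin n)) :
    Matrix (Fin n) (Fin n) ℝ :=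
  Matrix.of fun i j =>
    (fderiv ℝ (fun x : EuclideanSpace ℝ (Fin n) => V (x, 0)) 0 (EuclideanSpace.single j 1)) i

/-- `l` is a (complex) eigenvalue of the real square matrix `A`. -/
def IsEigenvalue {n : ℕ} (A : Matrix (Fin n) (Fin n) ℝ) (l : ℂ) : Prop :=
  Module.End.HasEigenvalue (Matrix.toLin' (A.map (algebraMap ℝ ℂ))) l

/-- `x` solves the singular initial value problem `dx/dr = V (x, r²) / r` for `0 < r < r₀`,
`x 0 = 0`. -/
structure IsSolution {n : ℕ} (V : EuclideanSpace ℝ (Fin n) × ℝ → EuclideanSpace ℝ (Fin n))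
    (r₀ : ℝ) (x : ℝ → EuclideanSpace ℝ (Fin n)) : Prop where
  pos : 0 < r₀
  zero : x 0 = 0
  ode : ∀ r ∈ Ioo (0 : ℝ) r₀, HasDerivAt x (r⁻¹ • V (x r, r ^ 2)) r

/-- Near `0`, `x` is a real-analytic function of `r²`: there are `ε > 0` and a real-analytic `g`
on `(-ε, ε)` with `g 0 = 0` such that `x r = g (r²)` for all `|r| < ε`. -/
def IsAnalyticInSq {n : ℕ} (x : ℝ → EuclideanSpace ℝ (Fin n)) : Prop :=
  ∃ ε : ℝ, 0 < ε ∧ ∃ g : ℝ → EuclideanSpace ℝ (Fin n),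
    AnalyticOnNhd ℝ g (Ioo (-ε) ε) ∧ g 0 = 0 ∧ ∀ r : ℝ, |r| < ε → x r = g (r ^ 2)

end

end SingularODE

/-!
With `ρ = r ^ 2` and `x r = g (r ^ 2)` the equation `dx/dr = V (x, r ^ 2) / r` becomes the
Briot-Bouquet equation `2 ρ g'(ρ) = V (g ρ, ρ)`, `g 0 = 0`. The number `2 k`, `k ≥ 1`, is not an
eigenvalue of `A = ∇ₓ V (0)`, because an eigenvalue equal to `2 k` would have real part `2 k`.

*Existence.* For `g = ∑ aₙ ρⁿ`, comparing coefficients gives `(2 n - A) aₙ = Fₙ (a₁, …, aₙ₋₁)`,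
where `Fₙ` is the `n`-th coefficient of the composition of the power series `p` of `V` with the
curve `ρ ↦ (g ρ, ρ)` truncated below order `n`. Non-resonance makes `2 n - A` invertible, which
defines `aₙ` recursively (`solutionCoeff`). The inverses are bounded uniformly in `n`
(`exists_bounded_resolvent`): for `2 n > ‖A‖ + 1` this holds for any `A`, and finitely many
`n` remain. Hence the coefficients satisfy the same majorant recursion as those of the inverse of
an analytic map, and they grow at most geometrically (`exists_pow_mul_le_of_composition_bound`,
`radius_graphSeries_solutionCoeff_pos`).

*Uniqueness.* If two analytic solutions differ near `0`, then `g₁ - g₂ = ρ ^ m e(ρ)` with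
`e 0 ≠ 0` and `m ≥ 1`. The difference of the equations, divided by `ρ ^ m`, gives
`2 m e(0) = A e(0)` as `ρ → 0⁺`, against non-resonance (`eventuallyEq_of_singular_ode`). Away from
`r = 0` the equation is regular with a `C¹` right-hand side, so equality near `0` propagates to the
common interval of existence (`eqOn_of_singular_ode`).
-/

namespace SingularODE

/-! ### Geometric bounds from a majorant recursion -/

open FormalMultilinearSeries in
/-- A nonnegative sequence dominated by the recursion that governs the coefficients of a composition
with a geometrically bounded power series grows at most geometrically. With
`S n = ∑ k ∈ [1, n), a ^ k * Q k`, the recursion gives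
`S (n + 1) ≤ I * a + D * ∑ k ∈ [2, n], (r * S n) ^ k`, and for small `a` this preserves
`S n ≤ (I + 1) * a`. -/
theorem exists_pow_mul_le_of_composition_bound {Q : ℕ → ℝ} (hQ : ∀ k, 0 ≤ Q k) {I D r : ℝ}
    (hI : 0 ≤ I) (hD : 0 ≤ D) (hr : 0 ≤ r) (hone : Q 1 ≤ I)
    (hrec : ∀ k, 2 ≤ k → Q k ≤
      D * ∑ c ∈ ({c | 1 < Composition.length c}.toFinset : Finset (Composition k)),
        r ^ c.length * ∏ j, Q (c.blocksFun j)) :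
    ∃ a M : ℝ, 0 < a ∧ ∀ n, 1 ≤ n → a ^ n * Q n ≤ M := by
  obtain ⟨a, apos, ha1, ha2⟩ :
      ∃ a : ℝ, 0 < a ∧ 2 * D * r ^ 2 * (I + 1) ^ 2 * a < 1 ∧ r * (I + 1) * a < 1 / 2 := by
    have h (c ε : ℝ) (hε : 0 < ε) : ∀ᶠ a in 𝓝[>] (0 : ℝ), c * a < ε := by
      have : Tendsto (fun a : ℝ => c * a) (𝓝 0) (𝓝 (c * 0)) := tendsto_const_nhds.mul tendsto_id
      exact ((tendsto_order.1 this).2 ε (by simpa using hε)).filter_mono inf_le_left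
    have hpos : ∀ᶠ a in 𝓝[>] (0 : ℝ), 0 < a := self_mem_nhdsWithin
    exact (hpos.and ((h _ 1 one_pos).and (h _ (1 / 2) (by norm_num)))).exists
  let S : ℕ → ℝ := fun n => ∑ k ∈ Finset.Ico 1 n, a ^ k * Q k
  have hS0 (n : ℕ) : 0 ≤ S n :=
    Finset.sum_nonneg fun k _ => mul_nonneg (pow_nonneg apos.le _) (hQ k)
  have hstep (n : ℕ) (hn : 1 ≤ n) :
      S (n + 1) ≤ I * a + D * ∑ k ∈ Finset.Ico 2 (n + 1), (r * S n) ^ k := by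
    have hsplit : S (n + 1) = a * Q 1 + ∑ k ∈ Finset.Ico 2 (n + 1), a ^ k * Q k := by
      simp only [S]
      rw [← Finset.sum_Ico_consecutive _ one_le_two (show 2 ≤ n + 1 by lia),
        show Finset.Ico 1 2 = {1} from Nat.Ico_succ_singleton 1, Finset.sum_singleton, pow_one]
    have hmaj := radius_right_inv_pos_of_radius_pos_aux1 n Q hQ hr apos.le
    have htail : ∑ k ∈ Finset.Ico 2 (n + 1), a ^ k * Q k ≤
        D * ∑ k ∈ Finset.Ico 2 (n + 1), a ^ k *
          ∑ c ∈ ({c | 1 < Composition.length c}.toFinset : Finset (Composition k)),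
            r ^ c.length * ∏ j, Q (c.blocksFun j) := by
      rw [Finset.mul_sum]
      refine Finset.sum_le_sum fun k hk => ?_
      rw [mul_left_comm]
      exact mul_le_mul_of_nonneg_left (hrec k (Finset.mem_Ico.1 hk).1) (pow_nonneg apos.le _)
    have hmaj' := mul_le_mul_of_nonneg_left hmaj hD
    simp_rw [← mul_pow] at hmaj'
    have := mul_le_mul_of_nonneg_left hone apos.le
    rw [hsplit]
    linarith
  have hbound (n : ℕ) (hn : 1 ≤ n) : S n ≤ (I + 1) * a := by
    induction n, hn using Nat.le_induction with
    | base => simp only [S, Finset.Ico_self, Finset.sum_empty]; positivity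
    | succ n hn ih =>
      have hrS : r * S n ≤ 1 / 2 := calc
        r * S n ≤ r * ((I + 1) * a) := by gcongr
        _ ≤ 1 / 2 := by rw [← mul_assoc]; exact ha2.le
      have hrS0 : 0 ≤ r * S n := mul_nonneg hr (hS0 n)
      calc
        S (n + 1) ≤ I * a + D * ∑ k ∈ Finset.Ico 2 (n + 1), (r * S n) ^ k := hstep n hn
        _ = I * a + D * (((r * S n) ^ 2 - (r * S n) ^ (n + 1)) / (1 - r * S n)) := by
          rw [geom_sum_Ico' _ (by lia)]
          linarith
        _ ≤ I * a + D * ((r * S n) ^ 2 / (1 / 2)) := by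
          gcongr
          · rw [sub_le_self_iff]
            positivity
          · linarith only [hrS]
        _ ≤ I * a + D * ((r * ((I + 1) * a)) ^ 2 / (1 / 2)) := by gcongr
        _ = (I + 2 * D * r ^ 2 * (I + 1) ^ 2 * a) * a := by ring
        _ ≤ (I + 1) * a := by gcongr
  refine ⟨a, (I + 1) * a, apos, fun n hn => le_trans ?_ (hbound (n + 1) (by lia))⟩
  exact Finset.single_le_sum (f := fun k => a ^ k * Q k)
    (fun k _ => mul_nonneg (pow_nonneg apos.le _) (hQ k)) (by simp [hn])

/-! ### Coefficients of a composition -/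

open FormalMultilinearSeries in
/-- The `n`-th coefficient of `q` enters the `n`-th coefficient of `p.comp q` only through the
linear part of `p`: this isolates the composition of `n` with a single block. -/
theorem comp_apply_eq_sum_add {𝕜 F G H : Type*} [NontriviallyNormedField 𝕜]
    [NormedAddCommGroup F] [NormedSpace 𝕜 F] [NormedAddCommGroup G] [NormedSpace 𝕜 G]
    [NormedAddCommGroup H] [NormedSpace 𝕜 H]
    (p : FormalMultilinearSeries 𝕜 G H) (q : FormalMultilinearSeries 𝕜 F G)
    {n : ℕ} (hn : 0 < n) (v : Fin n → F) :
    p.comp q n v =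
      ∑ c ∈ {c : Composition n | 1 < c.length}.toFinset,
          p c.length (q.applyComposition c v) + p 1 fun _ => q n v := by
  have hunion : (Finset.univ : Finset (Composition n)) =
      {c | 1 < Composition.length c}.toFinset ∪ {Composition.single n hn} := by
    refine Finset.Subset.antisymm (fun c _ => ?_) (Finset.subset_univ _)
    by_cases h : 1 < c.length
    · simp [h]
    · have : c.length = 1 := le_antisymm (not_lt.1 h) (c.length_pos_of_pos hn)
      rw [← Composition.eq_single_iff_length hn] at this
      simp [this]
  have hdisj : Disjoint ({c | 1 < Composition.length c} : Set (Composition n)).toFinset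
      {Composition.single n hn} := by
    simp
  have hsingle : p (Composition.single n hn).length
      (q.applyComposition (Composition.single n hn) v) = p 1 fun _ : Fin 1 => q n v := by
    apply p.congr (Composition.single_length hn) fun j hj1 _ => ?_
    simp [applyComposition_single]
  simp [FormalMultilinearSeries.comp, hunion, Finset.sum_union hdisj, hsingle,
    -Set.toFinset_ofPred, -add_right_inj, -Composition.single_length, -Finset.union_singleton]

theorem curryFin1_apply {𝕜 F G : Type*} [NontriviallyNormedField 𝕜]
    [NormedAddCommGroup F] [NormedSpace 𝕜 F] [NormedAddCommGroup G] [NormedSpace 𝕜 G]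
    (f : ContinuousMultilinearMap 𝕜 (fun _ : Fin 1 => F) G) (x : F) :
    continuousMultilinearCurryFin1 𝕜 F G f x = f fun _ => x :=
  congrArg f (funext fun i => by
    rw [show i = Fin.last 0 from Subsingleton.elim (α := Fin 1) _ _]
    exact Fin.snoc_last (α := fun _ => F) x 0)

variable {E : Type*} [NormedAddCommGroup E] [NormedSpace ℝ E]

/-! ### The formal solution and its convergence -/

/-- The power series of the curve `ρ ↦ (∑ₙ ρⁿ aₙ, ρ)` in `E × ℝ`, for `a 0 = 0` a curve through
the origin. -/
noncomputable def graphSeries (a : ℕ → E) : FormalMultilinearSeries ℝ ℝ (E × ℝ) := fun n =>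
  ContinuousMultilinearMap.mkPiRing ℝ (Fin n) (a n, if n = 1 then 1 else 0)

/-- The coefficients of the formal solution of `2 ρ g' = V (g, ρ)`, where `p` is the power series of
`V` at the origin and `R n` stands for the inverse of `2 n - ∇ₓ V (0)`. The `n`-th coefficient of
the composition is evaluated with the `n`-th and higher coefficients of `g` replaced by `0`, so
that it contains the lower coefficients only, and the linear term in `aₙ` has been moved
to the left-hand side. The map `R n` is any function here; that it inverts `2 n - ∇ₓ V (0)` is
required in the lemmas that use it. -/
noncomputable def solutionCoeff (p : FormalMultilinearSeries ℝ (E × ℝ) E) (R : ℕ → E → E) :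
    ℕ → E
  | 0 => 0
  | n + 1 =>
    let b : ℕ → E := fun k => if k < n + 1 then solutionCoeff p R k else 0
    R (n + 1) (p.comp (graphSeries b) (n + 1) fun _ => 1)

theorem norm_graphSeries (a : ℕ → E) (n : ℕ) :
    ‖graphSeries a n‖ = max ‖a n‖ (if n = 1 then 1 else 0) := by
  rw [graphSeries, ContinuousMultilinearMap.norm_mkPiRing, Prod.norm_def]
  split_ifs <;> simp

variable (p : FormalMultilinearSeries ℝ (E × ℝ) E) (R : ℕ → E → E)

theorem solutionCoeff_zero : solutionCoeff p R 0 = 0 := by rw [solutionCoeff]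

/-- The truncation in `solutionCoeff` can be dropped from the nonlinear terms, since a composition
of `n` with at least two blocks has all blocks smaller than `n`. -/
theorem solutionCoeff_of_pos {n : ℕ} (hn : 0 < n) :
    solutionCoeff p R n = R n
      (∑ c ∈ {c : Composition n | 1 < c.length}.toFinset,
          p c.length ((graphSeries (solutionCoeff p R)).applyComposition c fun _ => 1) +
        p 1 fun _ => (0, if n = 1 then 1 else 0)) := by
  obtain ⟨n, rfl⟩ := Nat.exists_eq_succ_of_ne_zero hn.ne'
  rw [Nat.succ_eq_add_one, solutionCoeff]
  refine congrArg (R (n + 1)) ((comp_apply_eq_sum_add p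
    (graphSeries fun k => if k < n + 1 then solutionCoeff p R k else 0) hn fun _ => 1).trans ?_)
  refine congrArg₂ (· + ·) ?_ ?_
  · refine Finset.sum_congr rfl fun c hc => p.congr rfl fun j hj1 hj2 => ?_
    have hlt : ∀ k, c.blocksFun k < n + 1 := by
      simp only [Set.mem_toFinset (s := {c : Composition (n + 1) | 1 < c.length}),
        Set.mem_ofPred_eq] at hc
      refine (Composition.ne_single_iff hn).1 fun h => ?_
      rw [Composition.eq_single_iff_length] at h
      lia
    simp [FormalMultilinearSeries.applyComposition, graphSeries, hlt]
  · simp [graphSeries]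

/-- The formal solution satisfies `2 ρ g' = V (g, ρ)` coefficientwise. -/
theorem comp_graphSeries_solutionCoeff {n : ℕ} (hn : 0 < n)
    (hR : ∀ w, (2 * n : ℝ) • R n w - p 1 (fun _ => (R n w, 0)) = w) :
    (p.comp (graphSeries (solutionCoeff p R)) n fun _ => 1) =
      (2 * n : ℝ) • solutionCoeff p R n := by
  refine (comp_apply_eq_sum_add p
    (graphSeries (solutionCoeff p R)) hn fun _ => 1).trans ?_
  have h := hR (∑ c ∈ {c : Composition n | 1 < c.length}.toFinset,
          p c.length ((graphSeries (solutionCoeff p R)).applyComposition c fun _ => 1) +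
        p 1 fun _ => (0, if n = 1 then 1 else 0))
  rw [← solutionCoeff_of_pos p R hn] at h
  have hq : (p 1 fun _ => graphSeries (solutionCoeff p R) n fun _ => 1) =
      p 1 (fun _ => (solutionCoeff p R n, 0)) + p 1 fun _ => (0, if n = 1 then 1 else 0) := by
    have := (continuousMultilinearCurryFin1 ℝ (E × ℝ) E (p 1)).map_add (solutionCoeff p R n, 0)
      (0, if n = 1 then 1 else 0)
    simp only [curryFin1_apply] at this
    simpa [graphSeries] using this
  rw [hq, eq_comm, ← sub_eq_iff_eq_add'.2 (sub_eq_iff_eq_add.1 h)]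
  abel

/-- The formal solution converges when the maps `R n` are uniformly bounded: the norms of the
coefficients of its graph satisfy the recursion of `exists_pow_mul_le_of_composition_bound`. -/
theorem radius_graphSeries_solutionCoeff_pos (hp : 0 < p.radius) {K : ℝ} (hK : 0 ≤ K)
    (hR : ∀ n, 0 < n → ∀ w, ‖R n w‖ ≤ K * ‖w‖) :
    0 < (graphSeries (solutionCoeff p R)).radius := by
  obtain ⟨C, r, Cpos, rpos, hC⟩ := p.le_mul_pow_of_radius_pos hp
  set q := graphSeries (solutionCoeff p R) with hq
  have hcomp (n : ℕ) : ‖∑ c ∈ {c : Composition n | 1 < c.length}.toFinset,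
      p c.length (q.applyComposition c fun _ => 1)‖ ≤
      C * ∑ c ∈ ({c | 1 < Composition.length c}.toFinset : Finset (Composition n)),
        r ^ c.length * ∏ j, ‖q (c.blocksFun j)‖ := by
    rw [Finset.mul_sum]
    refine norm_sum_le_of_le _ fun c _ => ?_
    have h := (q.compAlongComposition_bound c (p c.length) fun _ => 1)
    simp only [norm_one, Finset.prod_const_one, mul_one] at h
    refine h.trans ?_
    rw [← mul_assoc]
    exact mul_le_mul_of_nonneg_right (hC _) (Finset.prod_nonneg fun _ _ => norm_nonneg _)
  have hcoeff (n : ℕ) (hn : 0 < n) := hR n hn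
      (∑ c ∈ {c : Composition n | 1 < c.length}.toFinset,
          p c.length (q.applyComposition c fun _ => 1) +
        p 1 fun _ => (0, if n = 1 then 1 else 0))
  have hcoeff' (n : ℕ) (hn : 0 < n) : ‖solutionCoeff p R n‖ ≤ _ :=
    (congrArg norm (solutionCoeff_of_pos p R hn)).trans_le (hcoeff n hn)
  obtain ⟨a, M, apos, ha⟩ := exists_pow_mul_le_of_composition_bound
    (Q := fun n => ‖q n‖) (fun _ => norm_nonneg _) (I := max (K * ‖p 1 fun _ => (0, 1)‖) 1)
    (D := K * C) (by positivity) (by positivity) rpos.le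
    (by
      have h := hcoeff' 1 one_pos
      -- a composition of `1` has a single block, so only the inhomogeneous term `∂_ρ V (0)` is left
      have hempty : ({c : Composition 1 | 1 < c.length}.toFinset : Finset (Composition 1)) = ∅ := by
        ext c
        simp [c.length_le]
      rw [hempty] at h
      simp only [Finset.sum_empty, zero_add, if_true] at h
      simp only [hq, norm_graphSeries, if_true]
      exact max_le_max h le_rfl)
    (by
      intro k hk
      have h := hcoeff' k (by lia)
      have hk1 : k ≠ 1 := by lia
      have hz : (p 1 fun _ => ((0 : E), (0 : ℝ))) = 0 := (p 1).map_zero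
      simp only [if_neg hk1, hz, add_zero] at h
      simp only [hq, norm_graphSeries, if_neg hk1, max_eq_left (norm_nonneg _)]
      simp only [hq, norm_graphSeries] at hcomp
      rw [mul_assoc]
      exact h.trans (mul_le_mul_of_nonneg_left (hcomp k) hK))
  refine lt_of_lt_of_le ?_ (q.le_radius_of_eventually_le (r := ⟨a, apos.le⟩) M ?_)
  · exact ENNReal.coe_pos.2 apos
  · filter_upwards [eventually_ge_atTop 1] with n hn
    rw [mul_comm]
    exact ha n hn

/-! ### Non-resonance and the resolvent -/

theorem fderiv_apply_eq_jacobian_mulVec {n : ℕ}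
    (V : EuclideanSpace ℝ (Fin n) × ℝ → EuclideanSpace ℝ (Fin n)) (v : EuclideanSpace ℝ (Fin n))
    (i : Fin n) :
    (fderiv ℝ (fun x : EuclideanSpace ℝ (Fin n) => V (x, 0)) 0 v) i =
      (jacobian V).mulVec v.ofLp i := by
  have hv : v = ∑ j, v j • EuclideanSpace.single j (1 : ℝ) := by
    ext k
    simp [Finset.sum_apply, Pi.single_apply]
  conv_lhs => rw [hv]
  simp [jacobian, Matrix.mulVec, dotProduct, mul_comm]

/-- A real eigenvector of `∇ₓ V (0)` is also a complex eigenvector of the Jacobian matrix. -/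
theorem eq_zero_of_fderiv_apply_eq_smul {n : ℕ}
    {V : EuclideanSpace ℝ (Fin n) × ℝ → EuclideanSpace ℝ (Fin n)} {μ : ℝ}
    (hμ : ¬ IsEigenvalue (jacobian V) μ) {v : EuclideanSpace ℝ (Fin n)}
    (hv : fderiv ℝ (fun x : EuclideanSpace ℝ (Fin n) => V (x, 0)) 0 v = μ • v) : v = 0 := by
  by_contra hne
  refine hμ (Module.End.hasEigenvalue_of_hasEigenvector (x := fun i => (v i : ℂ))
    (Module.End.hasEigenvector_iff.2 ⟨Module.End.mem_eigenspace_iff.2 ?_, fun h => hne ?_⟩))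
  · ext i
    have h := congrArg (fun w : EuclideanSpace ℝ (Fin n) => ((w i : ℝ) : ℂ)) hv
    simp only [fderiv_apply_eq_jacobian_mulVec] at h
    simpa [Matrix.toLin'_apply, Matrix.mulVec, dotProduct] using h
  · ext i
    exact Complex.ofReal_eq_zero.1 (congrFun h i)



/-- If no `2 k`, `k ≥ 1`, is an eigenvalue of `A`, then the operators `2 k - A` have right inverses
that are bounded uniformly in `k`. -/
theorem exists_bounded_resolvent [FiniteDimensional ℝ E] (A : E →L[ℝ] E)
    (hA : ∀ k : ℕ, 0 < k → ∀ v, A v = (2 * k : ℝ) • v → v = 0) :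
    ∃ (R : ℕ → E → E) (K : ℝ), 0 ≤ K ∧ ∀ k : ℕ, 0 < k → ∀ w,
      (2 * k : ℝ) • R k w - A (R k w) = w ∧ ‖R k w‖ ≤ K * ‖w‖ := by
  have hexists (k : ℕ) : ∃ (S : E → E) (c : ℝ), 0 ≤ c ∧ (0 < k → ∀ w,
      (2 * k : ℝ) • S w - A (S w) = w ∧ ‖S w‖ ≤ c * ‖w‖) := by
    by_cases hk : 0 < k
    · let T : E →ₗ[ℝ] E := (2 * k : ℝ) • LinearMap.id - A.toLinearMap
      have hT : Function.Injective T := by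
        rw [← LinearMap.ker_eq_bot, LinearMap.ker_eq_bot']
        intro v hv
        exact hA k hk v (sub_eq_zero.1 hv).symm
      let e := LinearEquiv.ofInjectiveEndo T hT
      let S : E →L[ℝ] E := LinearMap.toContinuousLinearMap e.symm.toLinearMap
      exact ⟨S, ‖S‖, norm_nonneg _, fun _ w => ⟨e.apply_symm_apply w, S.le_opNorm w⟩⟩
    · exact ⟨id, 0, le_rfl, fun h => absurd h hk⟩
  choose S c hc hS using hexists
  obtain ⟨N, hN⟩ := exists_nat_gt (‖A‖ + 1)
  refine ⟨S, ∑ k ∈ Finset.range N, c k + 1,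
    add_nonneg (Finset.sum_nonneg fun k _ => hc k) zero_le_one, fun k hk w => ⟨(hS k hk w).1, ?_⟩⟩
  have hsum : 0 ≤ ∑ k ∈ Finset.range N, c k := Finset.sum_nonneg fun k _ => hc k
  by_cases hkN : k < N
  · refine (hS k hk w).2.trans (mul_le_mul_of_nonneg_right ?_ (norm_nonneg _))
    have := Finset.single_le_sum (f := c) (fun k _ => hc k) (Finset.mem_range.2 hkN)
    linarith
  -- for `k ≥ N > ‖A‖ + 1` the triangle inequality gives `‖S k w‖ ≤ ‖w‖`
  · have h1 : ‖(2 * k : ℝ) • S k w‖ ≤ ‖w‖ + ‖A‖ * ‖S k w‖ := calc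
      _ = ‖w + A (S k w)‖ := by rw [← sub_eq_iff_eq_add.1 (hS k hk w).1]
      _ ≤ ‖w‖ + ‖A‖ * ‖S k w‖ := (norm_add_le _ _).trans (by gcongr; exact A.le_opNorm _)
    rw [norm_smul, Real.norm_of_nonneg (by positivity)] at h1
    have h2 : (N : ℝ) ≤ k := by exact_mod_cast not_lt.1 hkN
    have h3 : (‖A‖ + 1) * ‖S k w‖ ≤ (2 * k : ℝ) * ‖S k w‖ :=
      mul_le_mul_of_nonneg_right (by linarith [norm_nonneg A]) (norm_nonneg _)
    nlinarith [mul_nonneg hsum (norm_nonneg w)]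

/-! ### The Briot-Bouquet equation `2 ρ g' = V (g, ρ)` -/

/-- Existence of an analytic solution of the non-resonant equation `2 ρ g' = V (g, ρ)`. -/
theorem exists_analyticAt_singular_ode [FiniteDimensional ℝ E] {V : E × ℝ → E}
    (hV : AnalyticAt ℝ V (0, 0)) (hV0 : V (0, 0) = 0)
    (hA : ∀ k : ℕ, 0 < k → ∀ v, fderiv ℝ V (0, 0) (v, 0) = (2 * k : ℝ) • v → v = 0) :
    ∃ g : ℝ → E, AnalyticAt ℝ g 0 ∧ g 0 = 0 ∧
      ∀ᶠ ρ in 𝓝 (0 : ℝ), (2 * ρ) • deriv g ρ = V (g ρ, ρ) := by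
  have : CompleteSpace E := FiniteDimensional.complete ℝ E
  obtain ⟨p, hp⟩ := hV
  have hp1 (v : E) : fderiv ℝ V (0, 0) (v, 0) = p 1 fun _ => (v, 0) := by
    rw [hp.fderiv_eq, curryFin1_apply]
  obtain ⟨R, K, hK, hR⟩ := exists_bounded_resolvent
    ((fderiv ℝ V (0, 0)).comp (ContinuousLinearMap.inl ℝ E ℝ)) fun k hk v hv =>
      hA k hk v (by simpa using hv)
  let a := solutionCoeff p R
  let q := graphSeries a
  have hq : 0 < q.radius := radius_graphSeries_solutionCoeff_pos p R hp.radius_pos hK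
    fun n hn w => (hR n hn w).2
  let y := q.sum
  have hy : HasFPowerSeriesOnBall y q 0 q.radius := q.hasFPowerSeriesOnBall hq
  have hy0 : y 0 = (0, 0) := by
    rw [← hy.coeff_zero Fin.elim0]
    simp [q, graphSeries, a, solutionCoeff_zero]
  have hqn (n : ℕ) (ρ : ℝ) : (q n fun _ => ρ) = ρ ^ n • (a n, if n = 1 then (1 : ℝ) else 0) := by
    simp [q, graphSeries]
  -- the second component of the sum is the identity
  have hsnd : ∀ᶠ ρ in 𝓝 (0 : ℝ), (y ρ).2 = ρ := by
    filter_upwards [hy.hasFPowerSeriesAt.eventually_hasSum] with ρ hρ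
    simp only [hqn, zero_add] at hρ
    have h := hρ.mapL (ContinuousLinearMap.snd ℝ E ℝ)
    have h' := hasSum_single (f := fun n : ℕ => ρ ^ n • (if n = 1 then (1 : ℝ) else 0)) 1
      fun n hn => by simp [hn]
    simp only [pow_one, if_true, smul_eq_mul, mul_one] at h'
    exact h.unique h'
  have hfst : AnalyticAt ℝ (fun ρ => (y ρ).1) 0 :=
    analyticAt_fst.comp hy.analyticAt
  refine ⟨fun ρ => (y ρ).1, hfst, by simp [hy0], ?_⟩
  have hcomp : HasFPowerSeriesAt (V ∘ y) (p.comp q) 0 := by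
    refine HasFPowerSeriesAt.comp ?_ hy.hasFPowerSeriesAt
    rwa [hy0]
  filter_upwards [hcomp.eventually_hasSum, hy.fderiv.hasFPowerSeriesAt.eventually_hasSum, hsnd,
    hy.analyticAt.eventually_analyticAt] with ρ h₁ h₂ h₃ h₄
  simp only [zero_add, Function.comp_apply] at h₁ h₂
  have hderiv : deriv (fun ρ => (y ρ).1) ρ = (fderiv ℝ y ρ 1).1 :=
    ((ContinuousLinearMap.fst ℝ E ℝ).hasFDerivAt.comp_hasDerivAt ρ
      h₄.differentiableAt.hasFDerivAt.hasDerivAt).deriv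
  -- the series of `ρ ↦ ρ g'(ρ)`, whose coefficients are `n aₙ`
  have h₅ := (h₂.mapL (ContinuousLinearMap.apply ℝ (E × ℝ) ρ)).mapL
    (ContinuousLinearMap.fst ℝ E ℝ)
  simp only [ContinuousLinearMap.apply_apply, FormalMultilinearSeries.derivSeries_apply_diag,
    hqn] at h₅
  have h₆ : HasSum (fun n : ℕ => (p.comp q (n + 1)) fun _ => ρ)
      ((2 : ℝ) • (fderiv ℝ y ρ ρ).1) := by
    have h := h₅.const_smul (2 : ℝ)
    rw [ContinuousLinearMap.coe_fst'] at h
    convert h using 1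
    funext n
    have hrec := comp_graphSeries_solutionCoeff p R n.succ_pos fun w => by
      have := (hR (n + 1) n.succ_pos w).1
      rwa [ContinuousLinearMap.comp_apply, ContinuousLinearMap.inl_apply, hp1] at this
    have hρ : (p.comp q (n + 1) fun _ => ρ) = ρ ^ (n + 1) • p.comp q (n + 1) fun _ => 1 := by
      simp
    rw [hρ, hrec]
    simp [smul_smul, a, ← Nat.cast_smul_eq_nsmul ℝ]
    congr 1
    ring
  -- the constant coefficient of the composition is `V (0, 0) = 0`
  have h₇ : HasSum (fun n : ℕ => (p.comp q n) fun _ => ρ) ((2 : ℝ) • (fderiv ℝ y ρ ρ).1) := by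
    rw [← hasSum_nat_add_iff' 1]
    have hz : (p.comp q 0 fun _ => ρ) = 0 := by
      rw [FormalMultilinearSeries.comp_coeff_zero', hp.coeff_zero, hV0]
    rwa [Finset.sum_range_one, hz, sub_zero]
  have hy' : fderiv ℝ y ρ ρ = ρ • fderiv ℝ y ρ 1 := by
    rw [← map_smul, smul_eq_mul, mul_one]
  have hpair : ((y ρ).1, ρ) = y ρ := Prod.ext rfl h₃.symm
  rw [hderiv, hpair, h₁.unique h₇, hy', Prod.smul_fst, smul_smul]

/-- Uniqueness of the germ of an analytic solution of the non-resonant equation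
`2 ρ g' = V (g, ρ)`. The equation is needed for `ρ > 0` only. -/
theorem eventuallyEq_of_singular_ode [CompleteSpace E] {V : E × ℝ → E}
    (hV : HasStrictFDerivAt V (fderiv ℝ V (0, 0)) (0, 0))
    (hA : ∀ k : ℕ, 0 < k → ∀ v, fderiv ℝ V (0, 0) (v, 0) = (2 * k : ℝ) • v → v = 0)
    {g₁ g₂ : ℝ → E} (hg₁ : AnalyticAt ℝ g₁ 0) (hg₂ : AnalyticAt ℝ g₂ 0)
    (h₁ : g₁ 0 = 0) (h₂ : g₂ 0 = 0)
    (hode₁ : ∀ᶠ ρ in 𝓝[>] (0 : ℝ), (2 * ρ) • deriv g₁ ρ = V (g₁ ρ, ρ))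
    (hode₂ : ∀ᶠ ρ in 𝓝[>] (0 : ℝ), (2 * ρ) • deriv g₂ ρ = V (g₂ ρ, ρ)) :
    g₁ =ᶠ[𝓝 0] g₂ := by
  by_contra hne
  have hd : AnalyticAt ℝ (g₁ - g₂) 0 := hg₁.sub hg₂
  have hne' : ¬ ∀ᶠ ρ in 𝓝 (0 : ℝ), (g₁ - g₂) ρ = 0 := fun h =>
    hne (h.mono fun ρ hρ => sub_eq_zero.1 hρ)
  obtain ⟨m, e, he, he0, hde⟩ := hd.exists_eventuallyEq_pow_smul_nonzero_iff.2 hne'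
  simp only [sub_zero] at hde
  have hm : 0 < m := by
    rcases Nat.eq_zero_or_pos m with rfl | h
    · have := hde.self_of_nhds
      simp [h₁, h₂] at this
      exact absurd this.symm he0
    · exact h
  -- the left-hand sides of the two equations, subtracted and divided by `ρ ^ m`
  have hlim₁ : Tendsto (fun ρ : ℝ => (2 * m : ℝ) • e ρ + (2 * ρ) • deriv e ρ) (𝓝[>] 0)
      (𝓝 ((2 * m : ℝ) • e 0)) := by
    have hc : ContinuousAt (fun ρ : ℝ => (2 * m : ℝ) • e ρ + (2 * ρ) • deriv e ρ) 0 :=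
      (he.continuousAt.const_smul _).add
        ((continuousAt_const.mul continuousAt_id).smul he.deriv.continuousAt)
    have := hc.tendsto
    simp only [mul_zero, zero_smul, add_zero] at this
    exact this.mono_left inf_le_left
  -- the right-hand sides, subtracted and divided by `ρ ^ m`
  have hlim₂ : Tendsto (fun ρ : ℝ => (ρ ^ m)⁻¹ • (V (g₁ ρ, ρ) - V (g₂ ρ, ρ))) (𝓝[>] 0)
      (𝓝 (fderiv ℝ V (0, 0) (e 0, 0))) := by
    have htend : Tendsto (fun ρ : ℝ => ((g₁ ρ, ρ), (g₂ ρ, ρ))) (𝓝[>] 0)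
        (𝓝 (((0 : E), (0 : ℝ)), ((0 : E), (0 : ℝ)))) := by
      have : ContinuousAt (fun ρ : ℝ => ((g₁ ρ, ρ), (g₂ ρ, ρ))) 0 :=
        (hg₁.continuousAt.prodMk continuousAt_id).prodMk
          (hg₂.continuousAt.prodMk continuousAt_id)
      have h := this.tendsto
      simp only [h₁, h₂] at h
      exact h.mono_left inf_le_left
    -- strict differentiability at the origin: the error is `o(‖g₁ ρ - g₂ ρ‖) = o(ρ ^ m)`
    have hlo := (hasStrictFDerivAt_iff_isLittleO.1 hV).comp_tendsto htend
    have hbig : (fun ρ : ℝ => (g₁ ρ, ρ) - (g₂ ρ, ρ)) =O[𝓝[>] 0] fun ρ : ℝ => ρ ^ m := by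
      have hb : (fun ρ : ℝ => ρ ^ m • e ρ) =O[𝓝 0] fun ρ : ℝ => ρ ^ m • (1 : ℝ) :=
        (Asymptotics.isBigO_refl _ _).smul
          (he.continuousAt.tendsto.isBigO_one ℝ)
      simp only [smul_eq_mul, mul_one] at hb
      have hb' : (g₁ - g₂) =O[𝓝 0] fun ρ : ℝ => ρ ^ m :=
        hb.congr' (hde.mono fun _ h => h.symm) (EventuallyEq.refl _ _)
      refine (Asymptotics.IsBigO.of_norm_left ?_).mono inf_le_left
      refine hb'.norm_left.congr_left fun ρ => ?_
      simp [Prod.norm_def]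
    have hlo' := hlo.trans_isBigO hbig
    have hz : Tendsto (fun ρ : ℝ => (ρ ^ m)⁻¹ • (V (g₁ ρ, ρ) - V (g₂ ρ, ρ) -
        fderiv ℝ V (0, 0) ((g₁ ρ, ρ) - (g₂ ρ, ρ)))) (𝓝[>] 0) (𝓝 0) :=
      hlo'.tendsto_inv_smul_nhds_zero
    have hA0 : Tendsto (fun ρ : ℝ => fderiv ℝ V (0, 0) (e ρ, 0)) (𝓝[>] 0)
        (𝓝 (fderiv ℝ V (0, 0) (e 0, 0))) := by
      have : ContinuousAt (fun ρ : ℝ => fderiv ℝ V (0, 0) (e ρ, 0)) 0 :=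
        (fderiv ℝ V (0, 0)).continuous.continuousAt.comp
          (he.continuousAt.prodMk continuousAt_const)
      exact this.tendsto.mono_left inf_le_left
    have := hz.add hA0
    rw [zero_add] at this
    refine this.congr' ?_
    filter_upwards [hde.filter_mono inf_le_left, self_mem_nhdsWithin] with ρ hρ hpos
    have hρm : ρ ^ m ≠ 0 := pow_ne_zero _ (ne_of_gt hpos)
    have hdiff : (g₁ ρ, ρ) - (g₂ ρ, ρ) = ρ ^ m • (e ρ, (0 : ℝ)) := by
      rw [Prod.mk_sub_mk, sub_self, Prod.smul_mk, smul_zero, ← hρ]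
      rfl
    rw [hdiff, map_smul, smul_sub, smul_smul _ (ρ ^ m), inv_mul_cancel₀ hρm, one_smul,
      sub_add_cancel]
  have heq : (fun ρ : ℝ => (2 * m : ℝ) • e ρ + (2 * ρ) • deriv e ρ) =ᶠ[𝓝[>] 0]
      fun ρ : ℝ => (ρ ^ m)⁻¹ • (V (g₁ ρ, ρ) - V (g₂ ρ, ρ)) := by
    have hderiv := (hde.eventually_nhds).filter_mono (inf_le_left : 𝓝[>] (0 : ℝ) ≤ 𝓝 0)
    filter_upwards [hderiv, hode₁, hode₂, self_mem_nhdsWithin,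
      he.eventually_analyticAt.filter_mono inf_le_left,
      hg₁.eventually_analyticAt.filter_mono inf_le_left,
      hg₂.eventually_analyticAt.filter_mono inf_le_left] with ρ hρ ho₁ ho₂ hpos hae ha₁ ha₂
    have hpos' : (0 : ℝ) < ρ := hpos
    have hD₁ : HasDerivAt (g₁ - g₂) (deriv g₁ ρ - deriv g₂ ρ) ρ :=
      ha₁.differentiableAt.hasDerivAt.sub ha₂.differentiableAt.hasDerivAt
    have hD₂ := ((hasDerivAt_pow m ρ).smul hae.differentiableAt.hasDerivAt).congr_of_eventuallyEq hρ
    have hD := hD₁.unique hD₂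
    rw [← ho₁, ← ho₂, ← smul_sub, hD, eq_inv_smul_iff₀ (pow_ne_zero _ hpos'.ne')]
    obtain ⟨k, rfl⟩ := Nat.exists_eq_succ_of_ne_zero hm.ne'
    simp only [smul_add, smul_smul, Nat.succ_eq_add_one, Nat.add_sub_cancel]
    rw [add_comm]
    congr 2 <;> ring
  exact he0 (hA m hm _ (tendsto_nhds_unique (hlim₂.congr' heq.symm) hlim₁))

/-! ### The equation in the variable `r` -/

/-- Away from `r = 0` the initial value problem is regular: on a compact interval `[a, b]` with
`0 < a`, both solutions stay in a ball on which the right-hand side is Lipschitz in `x`. -/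
theorem eqOn_of_singular_ode {V : E × ℝ → E} (hV : ContDiff ℝ 1 V) [ProperSpace E]
    {x₁ x₂ : ℝ → E} {a b : ℝ} (ha : 0 < a)
    (h₁ : ∀ r ∈ Icc a b, HasDerivAt x₁ (r⁻¹ • V (x₁ r, r ^ 2)) r)
    (h₂ : ∀ r ∈ Icc a b, HasDerivAt x₂ (r⁻¹ • V (x₂ r, r ^ 2)) r)
    (hab : x₁ a = x₂ a) : EqOn x₁ x₂ (Icc a b) := by
  have hc₁ : ContinuousOn x₁ (Icc a b) := fun r hr => (h₁ r hr).continuousAt.continuousWithinAt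
  have hc₂ : ContinuousOn x₂ (Icc a b) := fun r hr => (h₂ r hr).continuousAt.continuousWithinAt
  obtain ⟨M₁, hM₁⟩ := isCompact_Icc.exists_bound_of_continuousOn hc₁
  obtain ⟨M₂, hM₂⟩ := isCompact_Icc.exists_bound_of_continuousOn hc₂
  let B : Set E := Metric.closedBall 0 (max M₁ M₂)
  have hW : ContDiffOn ℝ 1 (fun z : E × ℝ => z.2⁻¹ • V (z.1, z.2 ^ 2)) (B ×ˢ Icc a b) := by
    refine ContDiffOn.smul (contDiffOn_snd.inv fun z hz => (ha.trans_le hz.2.1).ne') ?_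
    exact (hV.comp (contDiff_fst.prodMk (contDiff_snd.pow 2))).contDiffOn
  obtain ⟨L, hL⟩ := hW.exists_lipschitzOnWith one_ne_zero
    ((convex_closedBall _ _).prod (convex_Icc a b))
    ((isCompact_closedBall _ _).prod isCompact_Icc)
  refine ODE_solution_unique_of_mem_Icc_right (v := fun r x => r⁻¹ • V (x, r ^ 2))
    (s := fun _ => B) (K := L) (fun r hr => ?_) hc₁
    (fun r hr => (h₁ r (Ico_subset_Icc_self hr)).hasDerivWithinAt) (fun r hr => ?_) hc₂
    (fun r hr => (h₂ r (Ico_subset_Icc_self hr)).hasDerivWithinAt) (fun r hr => ?_) hab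
  · intro x hx y hy
    have := hL (x := (x, r)) ⟨hx, Ico_subset_Icc_self hr⟩ (y := (y, r))
      ⟨hy, Ico_subset_Icc_self hr⟩
    simpa [Prod.edist_eq] using this
  · exact mem_closedBall_zero_iff.2 ((hM₁ r (Ico_subset_Icc_self hr)).trans (le_max_left _ _))
  · exact mem_closedBall_zero_iff.2 ((hM₂ r (Ico_subset_Icc_self hr)).trans (le_max_right _ _))

variable {n : ℕ} {V : EuclideanSpace ℝ (Fin n) × ℝ → EuclideanSpace ℝ (Fin n)}

/-- A solution that is analytic in `r ^ 2` gives a germ solving `2 ρ g' = V (g, ρ)` for small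
`ρ > 0`, by the substitution `r = √ρ`. -/
theorem exists_analyticAt_of_isSolution {r₀ : ℝ} {x : ℝ → EuclideanSpace ℝ (Fin n)}
    (hx : IsSolution V r₀ x) (hxa : IsAnalyticInSq x) :
    ∃ g : ℝ → EuclideanSpace ℝ (Fin n), AnalyticAt ℝ g 0 ∧ g 0 = 0 ∧
      (∀ᶠ r in 𝓝 (0 : ℝ), x r = g (r ^ 2)) ∧
      ∀ᶠ ρ in 𝓝[>] (0 : ℝ), (2 * ρ) • deriv g ρ = V (g ρ, ρ) := by
  obtain ⟨ε, hε, g, hg, hg0, hxg⟩ := hxa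
  have hga : AnalyticAt ℝ g 0 := hg 0 ⟨by linarith, hε⟩
  have hev : ∀ᶠ r in 𝓝 (0 : ℝ), x r = g (r ^ 2) := by
    filter_upwards [Metric.ball_mem_nhds (0 : ℝ) hε] with r hr
    exact hxg r (by simpa using hr)
  refine ⟨g, hga, hg0, hev, ?_⟩
  have hsqrt : Tendsto Real.sqrt (𝓝[>] 0) (𝓝[>] 0) := by
    refine tendsto_nhdsWithin_iff.2 ⟨?_, ?_⟩
    · have := Real.continuous_sqrt.tendsto 0
      rw [Real.sqrt_zero] at this
      exact this.mono_left inf_le_left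
    · filter_upwards [self_mem_nhdsWithin] with ρ hρ using Real.sqrt_pos.2 hρ
  have hpos : ∀ᶠ r in 𝓝[>] (0 : ℝ), r ∈ Ioo 0 r₀ := Ioo_mem_nhdsGT hx.pos
  filter_upwards [hsqrt.eventually (hpos.and (hev.eventually_nhds.filter_mono inf_le_left)),
    hga.eventually_analyticAt.filter_mono inf_le_left, self_mem_nhdsWithin]
    with ρ ⟨hr, hxr⟩ hgρ hρ
  have hsq : √ρ ^ 2 = ρ := Real.sq_sqrt (le_of_lt hρ)
  have hne : √ρ ≠ 0 := hr.1.ne'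
  have hg' : HasDerivAt g (deriv g ρ) (√ρ ^ 2) := by
    rw [hsq]
    exact hgρ.differentiableAt.hasDerivAt
  have hD := (HasDerivAt.scomp (h := fun r : ℝ => r ^ 2) (√ρ) hg'
    (hasDerivAt_pow 2 (√ρ))).congr_of_eventuallyEq hxr
  have h := (hx.ode _ hr).unique hD
  rw [hxr.self_of_nhds, hsq, inv_smul_eq_iff₀ hne] at h
  rw [h, smul_smul]
  congr 1
  norm_num
  linear_combination (-2 : ℝ) * hsq

/-- Conversely, an analytic germ solving `2 ρ g' = V (g, ρ)` gives a solution in the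
variable `r`. -/
theorem isSolution_of_singular_ode {g : ℝ → EuclideanSpace ℝ (Fin n)}
    (hg : AnalyticAt ℝ g 0) (hg0 : g 0 = 0)
    (hode : ∀ᶠ ρ in 𝓝 (0 : ℝ), (2 * ρ) • deriv g ρ = V (g ρ, ρ)) :
    ∃ r₀ : ℝ, IsSolution V r₀ (fun r => g (r ^ 2)) ∧ IsAnalyticInSq fun r => g (r ^ 2) := by
  obtain ⟨ε, hε, hball⟩ := Metric.eventually_nhds_iff_ball.1 (hg.eventually_analyticAt.and hode)
  rw [Real.ball_eq_Ioo, zero_sub, zero_add] at hball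
  -- the bound `r < 1` ensures `r ^ 2 < r < ε`
  refine ⟨min 1 ε, ⟨lt_min one_pos hε, by simp [hg0], fun r hr => ?_⟩,
    ε, hε, g, fun ρ hρ => (hball ρ hρ).1, hg0, fun _ _ => rfl⟩
  have hr0 : 0 < r := hr.1
  have hr1 : r < 1 := hr.2.trans_le (min_le_left _ _)
  have hrε : r < ε := hr.2.trans_le (min_le_right _ _)
  obtain ⟨hga, ho⟩ := hball (r ^ 2) ⟨by nlinarith, by nlinarith⟩
  have hD := HasDerivAt.scomp (h := fun r : ℝ => r ^ 2) r hga.differentiableAt.hasDerivAt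
    (hasDerivAt_pow 2 r)
  refine HasDerivAt.congr_deriv hD ?_
  rw [← ho, smul_smul]
  congr 1
  field_simp
  norm_num [mul_comm]

end SingularODE

theorem corollary1 (n : ℕ)
    (V : EuclideanSpace ℝ (Fin n) × ℝ → EuclideanSpace ℝ (Fin n))
    (hV : AnalyticOnNhd ℝ V univ) (hV0 : V (0, 0) = 0)
    (hres : ∀ l : ℂ, SingularODE.IsEigenvalue (SingularODE.jacobian V) l →
      ∀ k : ℕ, 0 < k → l.re ≠ 2 * (k : ℝ)) :
    (∃ (r₀ : ℝ) (x : ℝ → EuclideanSpace ℝ (Fin n)),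
      SingularODE.IsSolution V r₀ x ∧ SingularODE.IsAnalyticInSq x) ∧
    (∀ (r₁ r₂ : ℝ) (x₁ x₂ : ℝ → EuclideanSpace ℝ (Fin n)),
      SingularODE.IsSolution V r₁ x₁ → SingularODE.IsAnalyticInSq x₁ →
      SingularODE.IsSolution V r₂ x₂ → SingularODE.IsAnalyticInSq x₂ →
      EqOn x₁ x₂ (Ico 0 (min r₁ r₂)) ∧ ∀ᶠ r in 𝓝 (0 : ℝ), x₁ r = x₂ r) := by
  have hV00 : AnalyticAt ℝ V (0, 0) := hV _ (mem_univ _)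
  have hA (k : ℕ) (hk : 0 < k) (v : EuclideanSpace ℝ (Fin n))
      (hv : fderiv ℝ V (0, 0) (v, 0) = (2 * k : ℝ) • v) : v = 0 := by
    refine SingularODE.eq_zero_of_fderiv_apply_eq_smul (V := V) (μ := 2 * k)
      (fun h => hres _ h k hk (Complex.ofReal_re _)) ?_
    have hpartial : HasFDerivAt (fun x : EuclideanSpace ℝ (Fin n) => V (x, 0)) _ 0 :=
      HasFDerivAt.comp (f := fun x : EuclideanSpace ℝ (Fin n) => (x, (0 : ℝ))) 0
        hV00.differentiableAt.hasFDerivAt (hasFDerivAt_prodMk_left 0 0)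
    rw [hpartial.fderiv]
    simpa using hv
  constructor
  · obtain ⟨g, hg, hg0, hode⟩ := SingularODE.exists_analyticAt_singular_ode hV00 hV0 hA
    obtain ⟨r₀, h⟩ := SingularODE.isSolution_of_singular_ode hg hg0 hode
    exact ⟨r₀, _, h⟩
  · intro r₁ r₂ x₁ x₂ hx₁ hxa₁ hx₂ hxa₂
    obtain ⟨g₁, hg₁, h₁0, hxg₁, ho₁⟩ := SingularODE.exists_analyticAt_of_isSolution hx₁ hxa₁
    obtain ⟨g₂, hg₂, h₂0, hxg₂, ho₂⟩ := SingularODE.exists_analyticAt_of_isSolution hx₂ hxa₂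
    have hgg := SingularODE.eventuallyEq_of_singular_ode hV00.hasStrictFDerivAt hA hg₁ hg₂
      h₁0 h₂0 ho₁ ho₂
    have hsq : Tendsto (fun r : ℝ => r ^ 2) (𝓝 0) (𝓝 0) := by
      simpa using (continuous_pow 2).tendsto (0 : ℝ)
    have hev : ∀ᶠ r in 𝓝 (0 : ℝ), x₁ r = x₂ r := by
      filter_upwards [hxg₁, hxg₂, hsq.eventually hgg] with r h₁ h₂ h
      rw [h₁, h₂, h]
    refine ⟨fun t ht => ?_, hev⟩
    rcases ht.1.eq_or_lt with rfl | htpos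
    · rw [hx₁.zero, hx₂.zero]
    obtain ⟨s, hs, hst⟩ := ((hev.filter_mono (nhdsWithin_le_nhds (s := Ioi 0))).and
      (Ioo_mem_nhdsGT htpos)).exists
    have hVC : ContDiff ℝ 1 V := contDiffOn_univ.1 (hV.contDiffOn uniqueDiffOn_univ)
    refine SingularODE.eqOn_of_singular_ode hVC hst.1
      (fun r hr => hx₁.ode r ⟨hst.1.trans_le hr.1, ?_⟩)
      (fun r hr => hx₂.ode r ⟨hst.1.trans_le hr.1, ?_⟩) hs ⟨hst.2.le, le_rfl⟩
    · exact hr.2.trans_lt (ht.2.trans_le (min_le_left _ _))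
    · exact hr.2.trans_lt (ht.2.trans_le (min_le_right _ _))
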